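/- Let $r\in\mathbb N$ and let $\Omega$ be a compact space. An $\mathfrak M_r$-bundle over $\Omega$ is a map $\mathcal B$ assigning to each $t\in\Omega$ a (not necessarily unital) $C^*$-subalgebra $\mathcal B(t)$ of $M_r=M_r(\mathbb C)$. Write $\mathcal B(\Omega):=\{x\in C(\Omega,M_r)\mid x(t)\in\mathcal B(t)\ \forall t\in\Omega\}$. The bundle $\mathcal B$ is unital if the $C^*$-algebra $\mathcal B(\Omega)$ has a unit (not necessarily the unit of $C(\Omega,M_r)$), and continuous if $\mathcal B(t)=\{x(t)\mid x\in\mathcal B(\Omega)\}$ for all $t\in\Omega$. A continuous bundle $\mathcal D$ is a subbundle of $\mathcal B$ if $\mathcal D(t)\subset\mathcal B(t)$ for all $t\in\Omega$. For a closed subspace $X\subset\Omega$, $\mathcal B|_X$ denotes the restriction of the map $\mathcal B$ to $X$, and $\mathcal B(X):=(\mathcal B|_X)(X)$. For a $C^*$-algebra $A$, $\mathcal Z(A)$ denotes its center, and $\mathcal Z(\mathcal B)$ denotes the bundle over $\Omega$ with fibers $\mathcal Z(\mathcal B)(t):=\{z(t)\mid z\in\mathcal Z(\mathcal B(\Omega))\}$.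 **Lemma.** Let $\Omega$ be compact and metrizable, $X\subset\Omega$ a closed subspace, and $\mathcal B$ a unital continuous $\mathfrak M_r$-bundle over $\Omega$. Then there is a unital continuous subbundle $\mathcal D\subset\mathcal B$ such that $\mathcal D|_X=\mathcal B|_X$ and $$\mathcal Z(\mathcal D)(X)=\mathcal Z(\mathcal D(X)),$$ that is, the algebra of continuous selections over $X$ of $\mathcal Z(\mathcal D)|_X$ equals the center of the algebra $\mathcal D(X)$ of continuous selections of $\mathcal D|_X$. -/

import Mathlib

/-- The algebra `M_r` of complex `r × r` matrices. Its topology is Mathlib's (entrywise) one, which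
is the topology of the `C*`-norm. -/
abbrev MatAlg (r : ℕ) : Type := Matrix (Fin r) (Fin r) ℂ

/-- A (not necessarily unital) `C*`-subalgebra of `M_r`. Since `M_r` is finite dimensional, every
`*`-subalgebra is closed, see `MatSubalg.isClosed`. -/
abbrev MatSubalg (r : ℕ) : Type := NonUnitalStarSubalgebra ℂ (MatAlg r)

theorem MatSubalg.isClosed {r : ℕ} (F : MatSubalg r) : IsClosed (F : Set (MatAlg r)) :=
  F.toNonUnitalSubalgebra.toSubmodule.closed_of_finiteDimensional

/-- An `𝔐_r`-bundle over `Ω`: a map assigning to each point a `C*`-subalgebra of `M_r`. -/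
abbrev MBundle (Ω : Type*) (r : ℕ) := Ω → MatSubalg r

/-- Evaluation at `t`, as a `*`-homomorphism `C(Ω, M_r) → M_r`. -/
noncomputable def evalAt {Ω : Type*} [TopologicalSpace Ω] {r : ℕ} (t : Ω) :
    C(Ω, MatAlg r) →⋆ₙₐ[ℂ] MatAlg r where
  toFun x := x t
  map_smul' _ _ := rfl
  map_zero' := rfl
  map_add' _ _ := rfl
  map_mul' _ _ := rfl
  map_star' _ := rfl

/-- The center of a `*`-subalgebra `A`, regarded as a `*`-subalgebra of the ambient algebra. -/
def centerIn {E : Type*} [NonUnitalRing E] [StarRing E] [Module ℂ E] [IsScalarTower ℂ E E]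
    [SMulCommClass ℂ E E] (A : NonUnitalStarSubalgebra ℂ E) : NonUnitalStarSubalgebra ℂ E :=
  (NonUnitalStarSubalgebra.center ℂ A).map (NonUnitalStarSubalgebraClass.subtype A)

theorem mem_centerIn {E : Type*} [NonUnitalRing E] [StarRing E] [Module ℂ E]
    [IsScalarTower ℂ E E] [SMulCommClass ℂ E E] (A : NonUnitalStarSubalgebra ℂ E) (z : E) :
    z ∈ centerIn A ↔ z ∈ A ∧ ∀ x ∈ A, x * z = z * x := by
  simp only [centerIn, NonUnitalStarSubalgebra.mem_map, NonUnitalStarSubalgebra.mem_center_iff]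
  constructor
  · rintro ⟨⟨y, hy⟩, hc, rfl⟩
    exact ⟨hy, fun x hx => congrArg Subtype.val (hc ⟨x, hx⟩)⟩
  · rintro ⟨hz, hc⟩
    exact ⟨⟨z, hz⟩, fun x => Subtype.ext (hc x.1 x.2), rfl⟩

namespace MBundle

/-- `B(Ω)`, the `*`-algebra of continuous selections of the bundle `B`. -/
def sections {Ω : Type*} [TopologicalSpace Ω] {r : ℕ} (B : MBundle Ω r) :
    NonUnitalStarSubalgebra ℂ C(Ω, MatAlg r) where
  carrier := {x | ∀ t, x t ∈ B t}
  add_mem' hx hy t := add_mem (hx t) (hy t)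
  zero_mem' t := zero_mem (B t)
  mul_mem' hx hy t := mul_mem (hx t) (hy t)
  smul_mem' c _ hx t := SMulMemClass.smul_mem c (hx t)
  star_mem' hx t := star_mem (hx t)

/-- `B` is unital: the algebra `B(Ω)` has a unit (which may differ from that of `C(Ω, M_r)`). -/
def IsUnital {Ω : Type*} [TopologicalSpace Ω] {r : ℕ} (B : MBundle Ω r) : Prop :=
  ∃ e ∈ B.sections, ∀ x ∈ B.sections, e * x = x ∧ x * e = x

/-- `B` is continuous: every fiber is exhausted by the values of continuous selections. -/
def IsContinuous {Ω : Type*} [TopologicalSpace Ω] {r : ℕ} (B : MBundle Ω r) : Prop :=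
  ∀ t, (B t : Set (MatAlg r)) = {b | ∃ x ∈ B.sections, x t = b}

/-- `B|_X`, the restriction of the bundle `B` to the subspace `X`. -/
def restrict {Ω : Type*} {r : ℕ} (B : MBundle Ω r) (X : Set Ω) : MBundle X r :=
  fun t => B t

/-- The bundle of fibers `t ↦ {b(t) | b ∈ A}` of a `*`-subalgebra `A` of `C(Ω, M_r)`. -/
noncomputable def ofSubalgebra {Ω : Type*} [TopologicalSpace Ω] {r : ℕ}
    (A : NonUnitalStarSubalgebra ℂ C(Ω, MatAlg r)) : MBundle Ω r :=
  fun t => A.map (evalAt t)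

/-- The center bundle `Z(B)`: the bundle of fibers of the center of `B(Ω)`. -/
noncomputable def center {Ω : Type*} [TopologicalSpace Ω] {r : ℕ} (B : MBundle Ω r) : MBundle Ω r :=
  ofSubalgebra (centerIn B.sections)

end MBundle

open Filter Topology
open scoped Matrix.Norms.L2Operator

/-! Values of central selections of `D` are central in the fibers of `D`, so one inclusion is free.
For the other, each value at `t ∈ X` of a central selection over `X` must come from a global central
selection of `D`. Such values form a finite-dimensional `*`-algebra, hence it suffices to treat
projections (`MatSubalg.le_of_forall_projection_mem`).

A projection value extends to a self-adjoint selection `P`, and functional calculus rounds `P` to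
`q`, a projection wherever `P` is nearly idempotent. Shrinking the fibers to the commutant of `q` on
a closed set `A` of such points makes `k q` central for every `k` vanishing off `A`. Over `X`
nothing shrinks, since `q` is already central there (`IsContinuous.exists_subbundle`).

This is repeated along a dense sequence of self-adjoint central selections over `X`, and the fibers
are intersected. The intersection stays continuous: off `X` the sequence is locally stationary
because the modified neighbourhoods shrink to `X`; over `X`, a dense sequence of selections of `B`
is deformed by summable amounts, without change on `X`, and so converges to common selections
(`isContinuous_iInf`). -/

theorem MatSubalg.real_smul_mem {r : ℕ} (F : MatSubalg r) (c : ℝ) {b : MatAlg r} (hb : b ∈ F) :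
    c • b ∈ F := by
  have h : c • b = (c : ℂ) • b := by ext i j; simp
  rw [h]
  exact SMulMemClass.smul_mem (c : ℂ) hb

/-- The orthogonal projections contained in a `*`-subalgebra of `M_r` generate it. -/
theorem MatSubalg.le_of_forall_projection_mem {r : ℕ} {F G : MatSubalg r}
    (h : ∀ p ∈ F, star p = p → p * p = p → p ∈ G) : F ≤ G := by
  have key : ∀ a ∈ F, IsSelfAdjoint a → a ∈ G := by
    intro a ha hsa
    have hfin : (quasispectrum ℝ a).Finite := by
      rw [quasispectrum_eq_spectrum_union_zero]
      have : (spectrum ℝ a).Finite := Matrix.finite_real_spectrum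
      exact this.union (Set.finite_singleton 0)
    have hcont : ∀ f : ℝ → ℝ, ContinuousOn f (quasispectrum ℝ a) := fun f =>
      hfin.continuousOn f
    have hclosed : IsClosed (F : Set (MatAlg r)) := F.isClosed
    have hF : ∀ f : ℝ → ℝ, cfcₙ f a ∈ F := fun f =>
      cfcₙ_mem (𝕜' := ℂ) (s := F) (hs := hclosed) f ha
    classical
    -- Spectral decomposition over the finite spectrum. The eigenvalue `0` is dropped because the
    -- non-unital calculus needs functions vanishing at `0`.
    have hsum : a = ∑ μ ∈ hfin.toFinset.erase 0,
        cfcₙ (fun x : ℝ => μ * if x = μ then 1 else 0) a := by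
      rw [← cfcₙ_sum (R := ℝ) (fun μ x => μ * if x = μ then 1 else 0) a _
        (fun i _ => hcont _)
        (fun i hi => by simp [(Finset.ne_of_mem_erase hi).symm])]
      conv_lhs => rw [← cfcₙ_id ℝ a]
      refine cfcₙ_congr fun x hx => ?_
      by_cases h0 : x = 0
      · subst h0
        rw [Finset.sum_apply]
        simp
      · rw [Finset.sum_apply, Finset.sum_eq_single x]
        · simp
        · intro b _ hb
          simp [hb.symm]
        · intro hx'
          simp [h0] at hx'
          exact absurd hx hx'
    rw [hsum]
    refine sum_mem fun μ hμ => ?_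
    have h0 : (0 : ℝ) ≠ μ := (Finset.ne_of_mem_erase hμ).symm
    rw [cfcₙ_const_mul μ (fun x => if x = μ then 1 else 0) a (hcont _) (if_neg h0)]
    refine MatSubalg.real_smul_mem G μ (h _ (hF _) ?_ ?_)
    · exact cfcₙ_predicate (R := ℝ) _ a
    · rw [← cfcₙ_mul _ _ a (hcont _) (by simp [h0]) (hcont _) (by simp [h0])]
      congr 1
      ext x
      simp
  intro a ha
  have h2 := realPart_add_I_smul_imaginaryPart a
  have hre : ((realPart a : selfAdjoint (MatAlg r)) : MatAlg r) ∈ F := by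
    rw [realPart_apply_coe]
    exact F.real_smul_mem _ (add_mem ha (star_mem ha))
  have him : ((imaginaryPart a : selfAdjoint (MatAlg r)) : MatAlg r) ∈ F := by
    rw [imaginaryPart_apply_coe]
    exact SMulMemClass.smul_mem _ (F.real_smul_mem _ (sub_mem ha (star_mem ha)))
  rw [← h2]
  exact add_mem (key _ hre (realPart a).2)
    (SMulMemClass.smul_mem _ (key _ him (imaginaryPart a).2))

/-! ### Selections of continuous bundles and their extension -/

namespace MBundle

variable {Ω : Type*} [TopologicalSpace Ω] {r : ℕ}

theorem mem_sections {B : MBundle Ω r} {x : C(Ω, MatAlg r)} :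
    x ∈ B.sections ↔ ∀ t, x t ∈ B t := Iff.rfl

theorem mem_center {B : MBundle Ω r} {t : Ω} {b : MatAlg r} :
    b ∈ B.center t ↔ ∃ z ∈ centerIn B.sections, z t = b := Iff.rfl

theorem sections_mono {B D : MBundle Ω r} (h : ∀ t, D t ≤ B t) : D.sections ≤ B.sections :=
  fun _ hx t => h t (hx t)

theorem IsContinuous.exists_section {B : MBundle Ω r} (hB : B.IsContinuous) {t : Ω}
    {b : MatAlg r} (hb : b ∈ B t) : ∃ x ∈ B.sections, x t = b := by
  have : b ∈ (B t : Set (MatAlg r)) := hb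
  rwa [hB t] at this

theorem isContinuous_of_exists_section {B : MBundle Ω r}
    (h : ∀ t, ∀ b ∈ B t, ∃ x ∈ B.sections, x t = b) : B.IsContinuous := by
  intro t
  ext b
  exact ⟨fun hb => h t b hb, fun ⟨x, hx, hxt⟩ => hxt ▸ hx t⟩

theorem smul_mem_sections {B : MBundle Ω r} (f : C(Ω, ℝ)) {x : C(Ω, MatAlg r)}
    (hx : x ∈ B.sections) : f • x ∈ B.sections :=
  fun t => (B t).real_smul_mem (f t) (hx t)

/-- A central section takes values in the centers of the fibers. -/
theorem IsContinuous.mem_centerIn_sections {B : MBundle Ω r} (hB : B.IsContinuous)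
    {z : C(Ω, MatAlg r)} :
    z ∈ centerIn B.sections ↔ ∀ t, z t ∈ centerIn (B t) := by
  simp only [mem_centerIn]
  constructor
  · rintro ⟨hz, hc⟩ t
    refine ⟨hz t, fun b hb => ?_⟩
    obtain ⟨x, hx, rfl⟩ := hB.exists_section hb
    exact congrArg (fun y : C(Ω, MatAlg r) => y t) (hc x hx)
  · intro h
    refine ⟨fun t => (h t).1, fun x hx => ?_⟩
    ext1 t
    exact (h t).2 _ (hx t)

theorem isClosed_sections (B : MBundle Ω r) : IsClosed (B.sections : Set C(Ω, MatAlg r)) := by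
  have : (B.sections : Set C(Ω, MatAlg r)) = ⋂ t, (fun x : C(Ω, MatAlg r) => x t) ⁻¹' (B t) := by
    ext x
    simp [mem_sections]
  rw [this]
  exact isClosed_iInter fun t => (B t).isClosed.preimage (by fun_prop)

section Compact

variable [CompactSpace Ω]

/-- Continuous selections over a closed subset are approximated by global ones. -/
theorem IsContinuous.exists_approx_extension [T2Space Ω] {B : MBundle Ω r} (hB : B.IsContinuous)
    {X : Set Ω} (hX : IsClosed X) {x : C(X, MatAlg r)} (hx : x ∈ (B.restrict X).sections)
    {ε : ℝ} (hε : 0 < ε) : ∃ y ∈ B.sections, ∀ t : X, ‖y t - x t‖ < ε := by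
  -- The constraints are convex and locally solvable, so a partition of unity glues local solutions.
  have hconv : ∀ ω, Convex ℝ {m : MatAlg r | m ∈ B ω ∧ ∀ h : ω ∈ X, ‖m - x ⟨ω, h⟩‖ < ε} := by
    intro ω
    have h1 : Convex ℝ {m : MatAlg r | m ∈ B ω} := by
      intro a ha b hb c d _ _ _
      exact add_mem ((B ω).real_smul_mem c ha) ((B ω).real_smul_mem d hb)
    by_cases h : ω ∈ X
    · convert h1.inter (convex_ball (x ⟨ω, h⟩) ε) using 1
      ext m
      simp [h, dist_eq_norm]
    · convert h1 using 1
      ext m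
      simp [h]
  obtain ⟨g, hg⟩ := exists_continuous_forall_mem_convex_of_local hconv (fun ω => by
    by_cases h : ω ∈ X
    · obtain ⟨y, hy, hyx⟩ := hB.exists_section (hx ⟨ω, h⟩)
      have hopen : IsOpen {s : X | ‖y s - x s‖ < ε} :=
        isOpen_lt (by fun_prop) continuous_const
      have hmem : {s : X | ‖y s - x s‖ < ε} ∈ 𝓝 (⟨ω, h⟩ : X) :=
        hopen.mem_nhds (by simp [hyx, hε])
      obtain ⟨U, hU, hUs⟩ := mem_nhds_subtype X ⟨ω, h⟩ _ |>.1 hmem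
      exact ⟨U, hU, y, y.continuous.continuousOn, fun s hs =>
        ⟨hy s, fun hsX => @hUs ⟨s, hsX⟩ hs⟩⟩
    · exact ⟨Xᶜ, hX.isOpen_compl.mem_nhds h, 0, continuousOn_const, fun s hs =>
        ⟨zero_mem _, fun hsX => absurd hsX hs⟩⟩)
  exact ⟨g, fun t => (hg t).1, fun t => (hg t).2 t.2⟩

/-- Radial truncation by a scalar function. It lifts restrictions without increasing the norm, as
needed to pass from approximate to exact extension. -/
theorem exists_section_norm_le {B : MBundle Ω r} {X : Set Ω} {y : C(Ω, MatAlg r)}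
    (hy : y ∈ B.sections) {c : ℝ} (hc : 0 ≤ c) (hyc : ∀ t ∈ X, ‖y t‖ ≤ c) :
    ∃ g ∈ B.sections, (∀ t ∈ X, g t = y t) ∧ ‖g‖ ≤ c := by
  rcases hc.eq_or_lt with h0 | h0
  · refine ⟨0, zero_mem _, fun t ht => ?_, by simp [← h0]⟩
    have := hyc t ht
    rw [← h0] at this
    exact (norm_le_zero_iff.1 this).symm
  let φ : C(Ω, ℝ) := ⟨fun t => c / max c ‖y t‖,
    continuous_const.div (by fun_prop) (fun t => (lt_max_of_lt_left h0).ne')⟩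
  have hφ : ∀ t, φ t = c / max c ‖y t‖ := fun _ => rfl
  refine ⟨φ • y, smul_mem_sections φ hy, fun t ht => ?_, ?_⟩
  · change φ t • y t = y t
    rw [hφ, max_eq_left (hyc t ht), div_self h0.ne', one_smul]
  · refine (ContinuousMap.norm_le _ h0.le).2 fun t => ?_
    change ‖φ t • y t‖ ≤ c
    have hm : 0 < max c ‖y t‖ := lt_max_of_lt_left h0
    rw [norm_smul, hφ, Real.norm_of_nonneg (by positivity), div_mul_eq_mul_div, div_le_iff₀ hm]
    exact mul_le_mul_of_nonneg_left (le_max_right _ _) h0.le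

/-- Continuous selections over a closed subset extend to the whole space. -/
theorem IsContinuous.exists_extension [T2Space Ω] {B : MBundle Ω r} (hB : B.IsContinuous)
    {X : Set Ω} (hX : IsClosed X) {x : C(X, MatAlg r)} (hx : x ∈ (B.restrict X).sections) :
    ∃ y ∈ B.sections, ∀ t : X, y t = x t := by
  have : CompactSpace X := isCompact_iff_compactSpace.1 hX.isCompact
  let S : AddSubgroup C(Ω, MatAlg r) := B.sections.toNonUnitalSubring.toAddSubgroup
  have hS : IsClosed (S : Set C(Ω, MatAlg r)) := B.isClosed_sections
  have : CompleteSpace S := hS.completeSpace_coe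
  let f : NormedAddGroupHom S C(X, MatAlg r) :=
    AddMonoidHom.mkNormedAddGroupHom
      { toFun := fun y => (y : C(Ω, MatAlg r)).comp ⟨Subtype.val, continuous_subtype_val⟩
        map_zero' := rfl
        map_add' := fun _ _ => rfl } 1 (fun y => by
          rw [one_mul]
          exact (ContinuousMap.norm_le _ (norm_nonneg _)).2 fun t =>
            (y : C(Ω, MatAlg r)).norm_coe_le_norm t)
  -- Norm-preserving lifts from the range of restriction, together with completeness, give lifts
  -- from its closure.
  have hyp : f.SurjectiveOnWith f.range 1 := by
    rintro h ⟨y, rfl⟩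
    change ∃ g, f g = f y ∧ _
    obtain ⟨g, hg, hgy, hn⟩ := exists_section_norm_le (X := X) y.2 (norm_nonneg (f y))
      (fun t ht => (f y).norm_coe_le_norm ⟨t, ht⟩)
    refine ⟨⟨g, hg⟩, ?_, by rw [one_mul]; exact hn⟩
    ext1 t
    exact hgy t t.2
  have hcl : x ∈ f.range.topologicalClosure := by
    change x ∈ closure (f.range : Set C(X, MatAlg r))
    refine Metric.mem_closure_iff.2 fun ε hε => ?_
    obtain ⟨y, hy, hyx⟩ := hB.exists_approx_extension hX hx hε
    refine ⟨f ⟨y, hy⟩, ⟨⟨y, hy⟩, rfl⟩, ?_⟩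
    rw [dist_comm, dist_eq_norm]
    exact (ContinuousMap.norm_lt_iff _ hε).2 fun t => hyx t
  obtain ⟨y, hyx, -⟩ := controlled_closure_of_complete one_pos one_pos hyp x hcl
  exact ⟨y, y.2, fun t =>
    congrArg (fun u : C(X, MatAlg r) => u t) hyx⟩

end Compact

end MBundle

/-! ### Rounding almost idempotents to projections -/

/-- A continuous function that is locally constant, with values `0` and `1`, near `0` and `1`. -/
noncomputable def roundUnit (x : ℝ) : ℝ := max 0 (min 1 (3 * x - 1))

theorem continuous_roundUnit : Continuous roundUnit := by
  unfold roundUnit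
  fun_prop

theorem roundUnit_zero : roundUnit 0 = 0 := by simp [roundUnit]

theorem abs_roundUnit_sub_le (x : ℝ) : |roundUnit x - x| ≤ 2 * |x * x - x| := by
  unfold roundUnit
  rcases le_or_gt (3 * x) 1 with h | h
  · rw [min_eq_right (by linarith), max_eq_left (by linarith), show x * x - x = x * (x - 1) by ring,
      zero_sub, abs_neg, abs_mul, abs_of_neg (by linarith : x - 1 < 0)]
    nlinarith [abs_nonneg x]
  rcases le_or_gt (3 * x) 2 with h' | h'
  · rw [min_eq_right (by linarith), max_eq_right (by linarith),
      abs_of_neg (by nlinarith : x * x - x < 0)]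
    refine abs_le.2 ⟨?_, ?_⟩ <;> nlinarith
  · rw [min_eq_left (by linarith), max_eq_right (by linarith),
      show x * x - x = x * (x - 1) by ring, abs_mul, abs_of_pos (by linarith : 0 < x),
      abs_sub_comm]
    nlinarith [abs_nonneg (x - 1)]

/-- On `[1/3, 2/3]`, where `roundUnit` is not locally constant, `|x * x - x| ≥ 2/9 > 1/5`. -/
theorem roundUnit_mul_self {x : ℝ} (h : |x * x - x| < 1 / 5) :
    roundUnit x * roundUnit x = roundUnit x := by
  obtain ⟨h1, h2⟩ := abs_lt.1 h
  unfold roundUnit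
  rcases le_or_gt (3 * x) 1 with h | h
  · rw [min_eq_right (by linarith), max_eq_left (by linarith), mul_zero]
  rcases le_or_gt (3 * x) 2 with h' | h'
  · nlinarith
  · rw [min_eq_left (by linarith), max_eq_right (by linarith), mul_one]

section

variable {r : ℕ} {p : MatAlg r}

theorem abs_le_norm_mul_self_sub (hp : IsSelfAdjoint p) {x : ℝ} (hx : x ∈ quasispectrum ℝ p) :
    |x * x - x| ≤ ‖p * p - p‖ := by
  have h := norm_apply_le_norm_cfcₙ (𝕜 := ℝ) (fun x : ℝ => x * x - x) p hx
    (by fun_prop) (by simp) hp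
  rwa [cfcₙ_sub (fun x : ℝ => x * x) (fun x => x) p, cfcₙ_mul (fun x : ℝ => x) (fun x => x) p,
    cfcₙ_id' ℝ p, Real.norm_eq_abs] at h

theorem norm_cfcₙ_roundUnit_sub_le (hp : IsSelfAdjoint p) :
    ‖cfcₙ roundUnit p - p‖ ≤ 2 * ‖p * p - p‖ := by
  have hc : ContinuousOn roundUnit (quasispectrum ℝ p) := continuous_roundUnit.continuousOn
  have h : cfcₙ roundUnit p - p = cfcₙ (fun x => roundUnit x - x) p := by
    rw [cfcₙ_sub roundUnit (fun x => x) p hc roundUnit_zero, cfcₙ_id' ℝ p]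
  rw [h]
  refine norm_cfcₙ_le fun x hx => ?_
  have := abs_le_norm_mul_self_sub hp hx
  rw [Real.norm_eq_abs]
  linarith [abs_roundUnit_sub_le x]

theorem cfcₙ_roundUnit_mul_self (hp : IsSelfAdjoint p) (h : ‖p * p - p‖ < 1 / 5) :
    cfcₙ roundUnit p * cfcₙ roundUnit p = cfcₙ roundUnit p := by
  have hc : ContinuousOn roundUnit (quasispectrum ℝ p) := continuous_roundUnit.continuousOn
  rw [← cfcₙ_mul _ _ p hc roundUnit_zero hc roundUnit_zero]
  exact cfcₙ_congr fun x hx =>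
    roundUnit_mul_self ((abs_le_norm_mul_self_sub hp hx).trans_lt h)

end

/-- The expectation `x ↦ q x q + (1 - q) x (1 - q)` onto the commutant of a projection `q`. -/
def pinch {A : Type*} [Ring A] (q x : A) : A := x - q * x - x * q + 2 * (q * x * q)

theorem pinch_commute {A : Type*} [Ring A] {q : A} (hq : q * q = q) (x : A) :
    pinch q x * q = q * pinch q x := by
  have h1 : ∀ y : A, q * (q * y) = q * y := fun y => by rw [← mul_assoc, hq]
  simp only [pinch, mul_add, add_mul, mul_sub, sub_mul, mul_assoc, hq, two_mul, h1]
  abel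

theorem pinch_eq_self {A : Type*} [Ring A] {q x : A} (hq : q * q = q) (h : x * q = q * x) :
    pinch q x = x := by
  have h2 : q * x * q = q * x := by rw [mul_assoc, h, ← mul_assoc, hq]
  rw [pinch, h2, h, two_mul]
  abel

theorem pinch_mem {r : ℕ} {F : MatSubalg r} {q x : MatAlg r} (hq : q ∈ F) (hx : x ∈ F) :
    pinch q x ∈ F := by
  rw [pinch, two_mul]
  have := mul_mem (mul_mem hq hx) hq
  exact add_mem (sub_mem (sub_mem hx (mul_mem hq hx)) (mul_mem hx hq)) (add_mem this this)

/-! ### One step: passing to the commutant of a selection -/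

namespace MBundle

variable {Ω : Type*} [TopologicalSpace Ω] {r : ℕ}

theorem IsContinuous.restrict {B : MBundle Ω r} (hB : B.IsContinuous) (X : Set Ω) :
    (B.restrict X).IsContinuous :=
  isContinuous_of_exists_section fun t _ hb => by
    obtain ⟨x, hx, hxt⟩ := hB.exists_section (t := (t : Ω)) hb
    exact ⟨x.comp ⟨Subtype.val, continuous_subtype_val⟩, fun s => hx s, hxt⟩

/-- The subbundle of `B` whose fiber over each point of `A` is the relative commutant of the value
of the self-adjoint selection `q`. -/
def commutantOn (B : MBundle Ω r) (q : C(Ω, MatAlg r)) (hq : star q = q) (A : Set Ω) :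
    MBundle Ω r := fun t =>
  { carrier := {b | b ∈ B t ∧ (t ∈ A → b * q t = q t * b)}
    add_mem' := fun ha hb => ⟨add_mem ha.1 hb.1, fun h => by
      rw [add_mul, mul_add, ha.2 h, hb.2 h]⟩
    zero_mem' := ⟨zero_mem _, fun _ => by simp⟩
    mul_mem' := fun {a b} ha hb => ⟨mul_mem ha.1 hb.1, fun h => by
      rw [mul_assoc, hb.2 h, ← mul_assoc, ha.2 h, mul_assoc]⟩
    smul_mem' := fun c b hb => ⟨SMulMemClass.smul_mem c hb.1, fun h => by
      rw [smul_mul_assoc, mul_smul_comm, hb.2 h]⟩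
    star_mem' := fun {b} hb => ⟨star_mem hb.1, fun h => by
      have hqt : star (q t) = q t := congrArg (fun y : C(Ω, MatAlg r) => y t) hq
      have := congrArg star (hb.2 h)
      rw [star_mul, star_mul, hqt] at this
      exact this.symm⟩ }

/-- At points of `A`, pinching by `q` pushes a selection into the commutant and fixes values already
there. At other points, a cutoff vanishing on `A` suffices. -/
theorem IsContinuous.commutantOn [T2Space Ω] [CompactSpace Ω] {B : MBundle Ω r}
    (hB : B.IsContinuous) {q : C(Ω, MatAlg r)} (hq : star q = q) (hqB : q ∈ B.sections)
    {A : Set Ω} (hA : IsClosed A) (hqA : ∀ t ∈ A, q t * q t = q t) :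
    (B.commutantOn q hq A).IsContinuous := by
  refine isContinuous_of_exists_section fun t b hb => ?_
  obtain ⟨x, hx, rfl⟩ := hB.exists_section hb.1
  by_cases ht : t ∈ A
  · refine ⟨pinch q x, fun s => ⟨?_, fun hs => ?_⟩, ?_⟩
    · exact pinch_mem (hqB s) (hx s)
    · exact pinch_commute (hqA s hs) (x s)
    · exact pinch_eq_self (hqA t ht) (hb.2 ht)
  · obtain ⟨f, hf0, hf1, -⟩ := exists_continuous_zero_one_of_isClosed hA (isClosed_singleton (x := t))
      (Set.disjoint_singleton_right.2 ht)
    refine ⟨f • x, fun s => ⟨smul_mem_sections f hx s, fun hs => ?_⟩, ?_⟩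
    · change (f s • x s) * q s = q s * (f s • x s)
      simp [hf0 hs]
    · change f t • x t = x t
      rw [hf1 rfl]
      exact one_smul _ _

/-- An approximately idempotent central selection `p` over `X` is realized by a
central selection of a subbundle agreeing with `B` on `X` and away from a neighbourhood of `X`,
and finitely many given selections are moved only a little. -/
theorem IsContinuous.exists_subbundle [T2Space Ω] [CompactSpace Ω] {B : MBundle Ω r}
    (hB : B.IsContinuous) {X : Set Ω} (hX : IsClosed X) {N : Set Ω} (hN : IsOpen N) (hXN : X ⊆ N)
    {p : C(X, MatAlg r)} (hp : p ∈ centerIn (B.restrict X).sections) (hps : star p = p)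
    {ι : Type*} [Finite ι] {y : ι → C(Ω, MatAlg r)} (hy : ∀ i, y i ∈ B.sections)
    {ε : ℝ} (hε : 0 < ε) :
    ∃ D : MBundle Ω r, D.IsContinuous ∧ (∀ t, D t ≤ B t) ∧ (∀ t ∈ X, D t = B t) ∧
      (∀ t ∉ N, D t = B t) ∧
      (∀ x ∈ B.sections, ∃ x' ∈ D.sections, (∀ t ∈ X, x' t = x t) ∧
        ∀ i, x = y i → ‖x' - x‖ ≤ ε) ∧
      centerIn B.sections ≤ centerIn D.sections ∧
      ∀ t : X, ‖p t * p t - p t‖ < 1 / 10 →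
        ∃ w ∈ centerIn D.sections, ‖w t - p t‖ ≤ 2 * ‖p t * p t - p t‖ := by
  have hpt := (hB.restrict X).mem_centerIn_sections.1 hp
  obtain ⟨p₀, hp₀, hp₀p⟩ := hB.exists_extension hX ((mem_centerIn _ _).1 hp).1
  -- a self-adjoint extension of `p`
  obtain ⟨P, hP, hPs, hPp⟩ : ∃ P ∈ B.sections, star P = P ∧ ∀ t : X, P t = p t := by
    refine ⟨(realPart p₀ : selfAdjoint C(Ω, MatAlg r)), fun t => ?_, (realPart p₀).2, fun t => ?_⟩
    · rw [realPart_apply_coe]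
      exact (B t).real_smul_mem _ (add_mem (hp₀ t) (star_mem (hp₀ t)))
    · rw [realPart_apply_coe]
      change (2⁻¹ : ℝ) • (p₀ t + star (p₀ t)) = p t
      have : star (p t) = p t := congrArg (fun u : C(X, MatAlg r) => u t) hps
      rw [hp₀p, this, ← two_smul ℝ, smul_smul]
      norm_num
  have hPt : ∀ t, IsSelfAdjoint (P t) := fun t => congrArg (fun u : C(Ω, MatAlg r) => u t) hPs
  set q : C(Ω, MatAlg r) := cfcₙ roundUnit P with hq_def
  have hqt : ∀ t, q t = cfcₙ roundUnit (P t) := fun t =>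
    NonUnitalStarAlgHomClass.map_cfcₙ (S := ℂ) (evalAt t) roundUnit P
      continuous_roundUnit.continuousOn roundUnit_zero (continuous_eval_const t) hPs (hPt t)
  have hqs : star q = q := cfcₙ_predicate (R := ℝ) roundUnit P
  have hqB : q ∈ B.sections :=
    cfcₙ_mem (𝕜' := ℂ) (s := B.sections) (hs := B.isClosed_sections) roundUnit hP
  have hqX : ∀ t ∈ X, ∀ b ∈ B t, b * q t = q t * b := by
    intro t ht b hb
    have hPc : P t ∈ centerIn (B t) := by
      rw [hPp ⟨t, ht⟩]
      exact hpt ⟨t, ht⟩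
    have hqc : q t ∈ centerIn (B t) := by
      rw [hqt]
      exact cfcₙ_mem (𝕜' := ℂ) (s := centerIn (B t)) (hs := MatSubalg.isClosed _) roundUnit hPc
    exact ((mem_centerIn _ _).1 hqc).2 b hb
  -- `φ` is positive exactly where `‖P² - P‖ < 1/5`, the range in which rounding yields a
  -- projection.
  let φ : C(Ω, ℝ) := ⟨fun t => max 0 (1 - 5 * ‖P t * P t - P t‖), by fun_prop⟩
  have hφ : ∀ t, φ t = max 0 (1 - 5 * ‖P t * P t - P t‖) := fun _ => rfl
  have hφ0 : ∀ t, 0 ≤ φ t := fun t => le_max_left _ _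
  have hqq : ∀ t, φ t ≠ 0 → q t * q t = q t := by
    intro t ht
    rw [hqt]
    refine cfcₙ_roundUnit_mul_self (hPt t) ?_
    by_contra! h
    exact ht (max_eq_left (by linarith))
  have hpinchX : ∀ t ∈ X, φ t ≠ 0 → ∀ b ∈ B t, pinch (q t) b = b := fun t ht h b hb =>
    pinch_eq_self (hqq t h) (hqX t ht b hb)
  have hpinch_cont : ∀ x : C(Ω, MatAlg r), Continuous fun t => pinch (q t) (x t) := by
    intro x
    unfold pinch
    fun_prop
  -- On `X` pinching is trivial wherever `φ ≠ 0`, so this open set contains `X`; on it the finitely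
  -- many `y i` move by less than `ε`.
  set U : Set Ω := {t | ∀ i, min 1 (2 * φ t) * ‖pinch (q t) (y i t) - y i t‖ < ε} ∩ N
  have hU : IsOpen U := by
    refine IsOpen.inter ?_ hN
    rw [Set.ofPred_forall]
    refine isOpen_iInter_of_finite fun i => isOpen_lt ?_ continuous_const
    have := hpinch_cont (y i)
    fun_prop
  have hXU : Disjoint Uᶜ X := by
    refine Set.disjoint_compl_left_iff_subset.2 fun t ht => ⟨fun i => ?_, hXN ht⟩
    by_cases h : φ t = 0
    · simpa [h] using hε
    · simpa [hpinchX t ht h _ (hy i t)] using hε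
  obtain ⟨χ, hχ0, hχ1, hχ⟩ := exists_continuous_zero_one_of_isClosed hU.isClosed_compl hX hXU
  let ψ : C(Ω, ℝ) := φ * χ
  have hψ : ∀ t, ψ t = φ t * χ t := fun _ => rfl
  have hψ0 : ∀ t, 0 ≤ ψ t := fun t => mul_nonneg (hφ0 t) (hχ t).1
  have hψφ : ∀ t, ψ t ≤ φ t := fun t => mul_le_of_le_one_right (hφ0 t) (hχ t).2
  have hψX : ∀ t ∈ X, ψ t = φ t := fun t ht => by rw [hψ, hχ1 ht]; exact mul_one _
  have hψU : ∀ t ∉ U, ψ t = 0 := fun t ht => by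
    rw [hψ, hχ0 ht]
    exact mul_zero _
  let A : Set Ω := {t | 1 / 2 ≤ ψ t}
  have hA : IsClosed A := isClosed_le continuous_const ψ.continuous
  have hqA : ∀ t ∈ A, q t * q t = q t := fun t ht => by
    have h1 : 1 / 2 ≤ ψ t := ht
    have h2 := hψφ t
    exact hqq t (by linarith)
  have hDB : ∀ t, B.commutantOn q hqs A t ≤ B t := fun t b hb => hb.1
  have hqD : q ∈ (B.commutantOn q hqs A).sections := fun t => ⟨hqB t, fun _ => rfl⟩
  refine ⟨B.commutantOn q hqs A, hB.commutantOn hqs hqB hA hqA, hDB,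
    fun t ht => le_antisymm (hDB t) fun b hb => ⟨hb, fun _ => hqX t ht b hb⟩,
    fun t ht => le_antisymm (hDB t) fun b hb => ⟨hb, fun hA' => ?_⟩, fun x hx => ?_,
    fun z hz => ?_, fun t ht => ?_⟩
  · have h1 : 1 / 2 ≤ ψ t := hA'
    rw [hψU t fun h => ht h.2] at h1
    norm_num at h1
  -- Interpolation between `x` and its pinching: fully pinched on `A`, where `2ψ ≥ 1`, and unchanged
  -- off `U`, where `ψ = 0`.
  · let x' : C(Ω, MatAlg r) :=
      ⟨fun t => x t + min 1 (2 * ψ t) • (pinch (q t) (x t) - x t), by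
        have := hpinch_cont x
        fun_prop⟩
    have hx' : ∀ t, x' t = x t + min 1 (2 * ψ t) • (pinch (q t) (x t) - x t) := fun _ => rfl
    have hmem : ∀ t, pinch (q t) (x t) ∈ B t := fun t => pinch_mem (hqB t) (hx t)
    refine ⟨x', fun t => ⟨?_, fun hA' => ?_⟩, fun t ht => ?_, fun i hi => ?_⟩
    · exact add_mem (hx t) ((B t).real_smul_mem _ (sub_mem (hmem t) (hx t)))
    · have h1 : 1 / 2 ≤ ψ t := hA'
      rw [hx', min_eq_left (by linarith), one_smul, add_sub_cancel]
      exact pinch_commute (hqA t hA') _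
    · rw [hx', hψX t ht]
      by_cases h : φ t = 0
      · simp [h]
      · simp [hpinchX t ht h _ (hx t)]
    · refine (ContinuousMap.norm_le _ hε.le).2 fun t => ?_
      change ‖x' t - x t‖ ≤ ε
      have h0 : 0 ≤ min 1 (2 * ψ t) := le_min zero_le_one (by linarith [hψ0 t])
      rw [hx', add_sub_cancel_left, norm_smul, Real.norm_of_nonneg h0]
      by_cases htU : t ∈ U
      · refine le_trans ?_ (htU.1 i).le
        rw [← hi]
        have := hψφ t
        gcongr
      · simp [hψU t htU, hε.le]
  · rw [mem_centerIn] at hz ⊢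
    refine ⟨fun t => ⟨hz.1 t, fun _ => ?_⟩, fun x hx => hz.2 x (sections_mono hDB hx)⟩
    exact (congrArg (fun u : C(Ω, MatAlg r) => u t) (hz.2 q hqB)).symm
  -- `k` vanishes off `A`, so `k q` is central. At `t`, `‖p² - p‖ < 1/10` gives `φ t > 1/2`, hence
  -- `k t > 0` and `k` can be normalized there.
  · let k : C(Ω, ℝ) := ⟨fun s => max 0 (2 * ψ s - 1), by fun_prop⟩
    have hk : ∀ s, k s = max 0 (2 * ψ s - 1) := fun _ => rfl
    have hkt : 0 < k t := by
      rw [hk, hψX t t.2, hφ, hPp]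
      exact lt_max_of_lt_right (by linarith [le_max_right 0 (1 - 5 * ‖p t * p t - p t‖)])
    let c : C(Ω, ℝ) := ContinuousMap.const Ω (k t)⁻¹
    refine ⟨(c * k) • q, (mem_centerIn _ _).2 ⟨smul_mem_sections _ hqD, fun x hx => ?_⟩, ?_⟩
    · ext1 s
      change x s * ((c s * k s) • q s) = ((c s * k s) • q s) * x s
      by_cases hs : s ∈ A
      · rw [smul_mul_assoc, mul_smul_comm, (hx s).2 hs]
      · have h1 : ¬ 1 / 2 ≤ ψ s := hs
        rw [hk, max_eq_left (by linarith)]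
        simp
    · change ‖((k t)⁻¹ * k t) • q t - p t‖ ≤ _
      rw [inv_mul_cancel₀ hkt.ne', one_smul, hqt, hPp]
      have := norm_cfcₙ_roundUnit_sub_le (hPt t)
      rwa [hPp] at this

end MBundle

/-! ### Iteration and intersection -/

namespace MBundle

variable {Ω : Type*} [TopologicalSpace Ω] {r : ℕ}

theorem mem_sections_iInf {D : ℕ → MBundle Ω r} {x : C(Ω, MatAlg r)} :
    x ∈ sections (fun t => ⨅ n, D n t) ↔ ∀ n, x ∈ (D n).sections := by
  simp only [mem_sections, NonUnitalStarAlgebra.mem_iInf]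
  exact forall_comm

variable [CompactSpace Ω]

/-- Continuity of the intersection of a decreasing sequence of continuous bundles that is locally
stationary off a set `X` and has enough common selections over `X`. -/
theorem isContinuous_iInf [T2Space Ω] {D : ℕ → MBundle Ω r} (hD : ∀ n, (D n).IsContinuous)
    {X : Set Ω}
    (hstat : ∀ t ∉ X, ∃ n, ∃ V, IsOpen V ∧ t ∈ V ∧ ∀ s ∈ V, ∀ m, D n s ≤ D m s)
    (happrox : ∀ t ∈ X, ∀ b ∈ D 0 t, ∀ ε > 0,
      ∃ z : C(Ω, MatAlg r), (∀ n, z ∈ (D n).sections) ∧ ‖z t - b‖ < ε) :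
    IsContinuous fun t => ⨅ n, D n t := by
  refine isContinuous_of_exists_section fun t b hb => ?_
  rw [NonUnitalStarAlgebra.mem_iInf] at hb
  by_cases ht : t ∈ X
  -- The values at `t` of common selections form a subspace of a finite-dimensional space, hence a
  -- closed set, so approximation is enough.
  · have hcl : b ∈ closure ((ofSubalgebra (sections fun t => ⨅ n, D n t) t : MatSubalg r) :
        Set (MatAlg r)) := by
      refine Metric.mem_closure_iff.2 fun ε hε => ?_
      obtain ⟨z, hz, hzt⟩ := happrox t ht b (hb 0) ε hε
      refine ⟨z t, ⟨z, mem_sections_iInf.2 hz, rfl⟩, ?_⟩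
      rwa [dist_comm, dist_eq_norm]
    rw [(MatSubalg.isClosed _).closure_eq] at hcl
    exact hcl
  · obtain ⟨n, V, hV, htV, hn⟩ := hstat t ht
    obtain ⟨x, hx, rfl⟩ := (hD n).exists_section (hb n)
    obtain ⟨f, hf0, hf1, -⟩ := exists_continuous_zero_one_of_isClosed hV.isClosed_compl
      (isClosed_singleton (x := t)) (by simpa using htV)
    refine ⟨f • x, mem_sections_iInf.2 fun m s => ?_, ?_⟩
    · by_cases hs : s ∈ V
      · exact hn s hs m (smul_mem_sections f hx s)
      · change f s • x s ∈ D m s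
        rw [hf0 hs]
        simp
    · change f t • x t = x t
      rw [hf1 rfl]
      exact one_smul _ _

/-- Successive applications of `IsContinuous.exists_subbundle`, along a sequence `p` of central
selections over `X` and a sequence `N` of neighbourhoods of `X`. -/
theorem IsContinuous.exists_seq_subbundle [T2Space Ω] {B : MBundle Ω r} (hB : B.IsContinuous)
    {X : Set Ω} (hX : IsClosed X) {N : ℕ → Set Ω} (hN : ∀ n, IsOpen (N n)) (hXN : ∀ n, X ⊆ N n)
    {p : ℕ → C(X, MatAlg r)} (hp : ∀ n, p n ∈ centerIn (B.restrict X).sections)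
    (hps : ∀ n, star (p n) = p n) {y : ℕ → C(Ω, MatAlg r)} (hy : ∀ i, y i ∈ B.sections) :
    ∃ (D : ℕ → MBundle Ω r) (Y : ℕ → ℕ → C(Ω, MatAlg r)), D 0 = B ∧
      (∀ n, (D n).IsContinuous) ∧ (∀ n t, D (n + 1) t ≤ D n t) ∧
      (∀ n, ∀ t ∈ X, D n t = B t) ∧ (∀ n, ∀ t ∉ N n, D (n + 1) t = D n t) ∧
      (∀ n i, Y n i ∈ (D n).sections) ∧ (∀ n i, ∀ t ∈ X, Y n i t = y i t) ∧
      (∀ n, ∀ i ≤ n, ‖Y (n + 1) i - Y n i‖ ≤ (1 / 2) ^ n) ∧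
      (∀ n, centerIn (D n).sections ≤ centerIn (D (n + 1)).sections) ∧
      ∀ n, ∀ t : X, ‖p n t * p n t - p n t‖ < 1 / 10 →
        ∃ w ∈ centerIn (D (n + 1)).sections, ‖w t - p n t‖ ≤ 2 * ‖p n t * p n t - p n t‖ := by
  let Good : MBundle Ω r × (ℕ → C(Ω, MatAlg r)) → Prop := fun s =>
    s.1.IsContinuous ∧ (∀ t ∈ X, s.1 t = B t) ∧ (∀ i, s.2 i ∈ s.1.sections) ∧
      ∀ i, ∀ t ∈ X, s.2 i t = y i t
  have step : ∀ n (s : Subtype Good), ∃ s' : Subtype Good,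
      (∀ t, s'.1.1 t ≤ s.1.1 t) ∧ (∀ t ∉ N n, s'.1.1 t = s.1.1 t) ∧
      (∀ i ≤ n, ‖s'.1.2 i - s.1.2 i‖ ≤ (1 / 2) ^ n) ∧
      centerIn s.1.1.sections ≤ centerIn s'.1.1.sections ∧
      ∀ t : X, ‖p n t * p n t - p n t‖ < 1 / 10 →
        ∃ w ∈ centerIn s'.1.1.sections, ‖w t - p n t‖ ≤ 2 * ‖p n t * p n t - p n t‖ := by
    rintro n ⟨⟨D, Y⟩, hDc, hDX, hY, hYX⟩
    -- Agreement with `B` over `X` keeps `p n` central at every stage.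
    have hres : D.restrict X = B.restrict X := funext fun t => hDX t t.2
    obtain ⟨D', hc, hle, hX', hN', hlift, hcen, hproj⟩ := hDc.exists_subbundle hX (hN n) (hXN n)
      (hres ▸ hp n) (hps n) (y := fun i : Fin (n + 1) => Y i) (fun i => hY i)
      (ε := (1 / 2) ^ n) (by positivity)
    choose Y' hY' hYX' hYn' using fun i => hlift (Y i) (hY i)
    exact ⟨⟨⟨D', Y'⟩, hc, fun t ht => (hX' t ht).trans (hDX t ht), hY', fun i t ht =>
      (hYX' i t ht).trans (hYX i t ht)⟩, hle, hN',
      fun i hi => hYn' i ⟨i, Nat.lt_succ_of_le hi⟩ rfl, hcen, hproj⟩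
  choose next hnext using step
  let S : ℕ → Subtype Good := fun n =>
    Nat.rec ⟨⟨B, y⟩, hB, fun _ _ => rfl, hy, fun _ _ _ => rfl⟩ next n
  exact ⟨fun n => (S n).1.1, fun n => (S n).1.2, rfl, fun n => (S n).2.1,
    fun n => (hnext n (S n)).1, fun n => (S n).2.2.1, fun n => (hnext n (S n)).2.1,
    fun n => (S n).2.2.2.1, fun n => (S n).2.2.2.2, fun n => (hnext n (S n)).2.2.1,
    fun n => (hnext n (S n)).2.2.2.1, fun n => (hnext n (S n)).2.2.2.2⟩

/-- A bundle over a metrizable space has a subbundle agreeing with it on `X` whose center realizes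
all values of central selections over `X`. -/
theorem IsContinuous.exists_subbundle_center [TopologicalSpace.MetrizableSpace Ω]
    {B : MBundle Ω r} (hB : B.IsContinuous) {X : Set Ω} (hX : IsClosed X) :
    ∃ D : MBundle Ω r, D.IsContinuous ∧ (∀ t, D t ≤ B t) ∧ (∀ t ∈ X, D t = B t) ∧
      centerIn B.sections ≤ centerIn D.sections ∧
      ∀ z ∈ centerIn (B.restrict X).sections, ∀ t : X, z t ∈ D.center t := by
  let _ := TopologicalSpace.metrizableSpaceMetric Ω
  have : CompactSpace X := isCompact_iff_compactSpace.1 hX.isCompact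
  obtain ⟨y, hy⟩ := TopologicalSpace.exists_dense_seq B.sections
  let Q := {q : C(X, MatAlg r) // q ∈ centerIn (B.restrict X).sections ∧ star q = q}
  have : Nonempty Q := ⟨⟨0, zero_mem _, star_zero _⟩⟩
  obtain ⟨p, hp⟩ := TopologicalSpace.exists_dense_seq Q
  obtain ⟨D, Y, hD0, hDc, hDle, hDX, hDN, hY, hYX, hYn, hcen, hproj⟩ :=
    hB.exists_seq_subbundle hX (N := fun n : ℕ => Metric.thickening (1 / (n + 1 : ℝ)) X)
      (fun n => Metric.isOpen_thickening)
      (fun n => Metric.self_subset_thickening (by positivity) X)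
      (p := fun n => (p n).1) (fun n => (p n).2.1) (fun n => (p n).2.2)
      (y := fun i => (y i : C(Ω, MatAlg r))) (fun i => (y i).2)
  have hanti : ∀ t, Antitone fun n => D n t := fun t => antitone_nat_of_succ_le fun n => hDle n t
  have hmono : Monotone fun n => centerIn (D n).sections := monotone_nat_of_le_succ hcen
  have hcenD : ∀ n, centerIn (D n).sections ≤ centerIn (sections fun t => ⨅ n, D n t) := by
    intro n z hz
    refine (mem_centerIn _ _).2 ⟨mem_sections_iInf.2 fun m => ?_, fun x hx =>
      ((mem_centerIn _ _).1 hz).2 x (mem_sections_iInf.1 hx n)⟩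
    have h1 := ((mem_centerIn _ _).1 (hmono (le_max_left n m) hz)).1
    exact fun t => hanti t (le_max_right n m) (h1 t)
  refine ⟨fun t => ⨅ n, D n t, isContinuous_iInf hDc (X := X) (fun t ht => ?_)
    (fun t ht b hb ε hε => ?_), fun t => ?_, fun t ht => ?_, ?_, fun z hz t => ?_⟩
  -- Once `1/(n+1) < δ/2`, the later thickenings of `X` miss the ball of radius `δ/2` about `t`.
  · obtain ⟨δ, hδ, hball⟩ := Metric.isOpen_iff.1 hX.isOpen_compl t ht
    obtain ⟨n, hn⟩ := exists_nat_one_div_lt (half_pos hδ)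
    refine ⟨n, Metric.ball t (δ / 2), Metric.isOpen_ball, Metric.mem_ball_self (half_pos hδ),
      fun s hs m => ?_⟩
    rcases le_total m n with hmn | hmn
    · exact hanti s hmn
    · refine le_of_eq ?_
      induction m, hmn using Nat.le_induction with
      | base => rfl
      | succ m hm ih =>
        rw [ih, hDN m s]
        intro hs'
        obtain ⟨x, hx, hsx⟩ := Metric.mem_thickening_iff.1 hs'
        refine hball (Metric.mem_ball.2 ?_) hx
        have h1 : (1 : ℝ) / (m + 1) ≤ 1 / (n + 1) := by gcongr
        have h2 : dist x t ≤ dist s x + dist s t := dist_triangle_left x t s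
        have h3 := Metric.mem_ball.1 hs
        linarith
  · rw [hD0] at hb
    obtain ⟨x, hx, rfl⟩ := hB.exists_section hb
    obtain ⟨i, hi⟩ := hy.exists_dist_lt ⟨x, hx⟩ hε
    -- The index is shifted by `i` because the `i`-th selection is controlled only from stage `i`
    -- on.
    have hcauchy : CauchySeq fun n => Y (n + i) i := by
      refine cauchySeq_of_le_geometric (1 / 2) 1 (by norm_num) fun n => ?_
      rw [dist_comm, dist_eq_norm, one_mul, add_right_comm]
      refine (hYn (n + i) i (Nat.le_add_left i n)).trans ?_
      exact pow_le_pow_of_le_one (by norm_num) (by norm_num) (Nat.le_add_right n i)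
    obtain ⟨z, hz⟩ := cauchySeq_tendsto_of_complete hcauchy
    refine ⟨z, fun n => ?_, ?_⟩
    · refine (D n).isClosed_sections.mem_of_tendsto hz ?_
      filter_upwards [eventually_ge_atTop n] with m hm s
      exact hanti s (hm.trans (Nat.le_add_right m i)) (hY (m + i) i s)
    · have hzt : z t = (y i : C(Ω, MatAlg r)) t := by
        have h1 := ((ContinuousEvalConst.continuous_eval_const t).tendsto z).comp hz
        refine tendsto_nhds_unique h1 ?_
        simp only [Function.comp_def, hYX _ _ t ht]
        exact tendsto_const_nhds
      rw [hzt, ← dist_eq_norm, dist_comm]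
      exact (ContinuousMap.dist_apply_le_dist t).trans_lt hi
  · exact (iInf_le _ 0).trans (by rw [hD0])
  · simp only [hDX _ t ht, iInf_const]
  · rw [← hD0]
    exact hcenD 0
  · have key : ((centerIn (B.restrict X).sections).map (evalAt t) : MatSubalg r) ≤
        center (fun t => ⨅ n, D n t) t := by
      refine MatSubalg.le_of_forall_projection_mem ?_
      rintro b ⟨q₀, hq₀, hqb⟩ hbs hbb
      replace hqb : q₀ t = b := hqb
      -- The self-adjoint part has the same value at `t`, since `b` is self-adjoint.
      obtain ⟨q, hq⟩ : ∃ q : Q, q.1 t = b := by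
        refine ⟨⟨(2⁻¹ : ℂ) • (q₀ + star q₀),
          SMulMemClass.smul_mem _ (add_mem hq₀ (star_mem hq₀)), ?_⟩, ?_⟩
        · rw [star_smul, star_add, star_star, add_comm]
          simp
        · change (2⁻¹ : ℂ) • (q₀ t + star (q₀ t)) = b
          rw [hqb, hbs, ← two_smul ℂ, smul_smul]
          norm_num
      have hcl : b ∈ closure ((center (fun t => ⨅ n, D n t) t : MatSubalg r) :
          Set (MatAlg r)) := by
        refine Metric.mem_closure_iff.2 fun ε hε => ?_
        have hev : Continuous fun q' : Q => q'.1 t :=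
          (ContinuousEvalConst.continuous_eval_const t).comp continuous_subtype_val
        -- Density supplies `p n` close to `b` at `t`, hence almost idempotent there. Rounding costs
        -- at most `2 · ε/4`, and `p n` is within `ε/2` of `b`.
        obtain ⟨n, hn⟩ := hp.exists_mem_open
          (s := {q' : Q | ‖q'.1 t * q'.1 t - q'.1 t‖ < min (1 / 10) (ε / 4)} ∩
            {q' : Q | ‖q'.1 t - b‖ < ε / 2})
          ((isOpen_lt ((hev.mul hev).sub hev).norm continuous_const).inter
            (isOpen_lt (hev.sub continuous_const).norm continuous_const))
          ⟨q, by
            simp only [Set.mem_inter_iff, Set.mem_ofPred_eq, hq, hbb, sub_self, norm_zero]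
            exact ⟨by positivity, by positivity⟩⟩
        obtain ⟨w, hw, hwt⟩ := hproj n t (hn.1.trans_le (min_le_left _ _))
        refine ⟨w t, ⟨w, hcenD _ hw, rfl⟩, ?_⟩
        have h1 : ‖(p n).1 t * (p n).1 t - (p n).1 t‖ < ε / 4 := hn.1.trans_le (min_le_right _ _)
        have h2 : ‖(p n).1 t - b‖ < ε / 2 := hn.2
        have h3 := dist_triangle (w t) ((p n).1 t) b
        simp only [dist_eq_norm] at h3
        rw [dist_comm, dist_eq_norm]
        linarith
      rwa [(MatSubalg.isClosed _).closure_eq] at hcl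
    exact key ⟨z, hz, rfl⟩

end MBundle

theorem mainTheorem4 {Ω : Type*} [TopologicalSpace Ω] [CompactSpace Ω]
    [TopologicalSpace.MetrizableSpace Ω] (X : Set Ω) (hX : IsClosed X) (r : ℕ)
    (B : MBundle Ω r) (hBu : MBundle.IsUnital B) (hBc : MBundle.IsContinuous B) :
    ∃ D : MBundle Ω r, MBundle.IsUnital D ∧ MBundle.IsContinuous D ∧
      (∀ t, D t ≤ B t) ∧
      MBundle.restrict D X = MBundle.restrict B X ∧
      MBundle.sections (MBundle.restrict (MBundle.center D) X) =
        centerIn (MBundle.sections (MBundle.restrict D X)) := by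
  obtain ⟨D, hDc, hDB, hDX, hcen, hval⟩ := hBc.exists_subbundle_center hX
  have hres : D.restrict X = B.restrict X := funext fun t => hDX t t.2
  obtain ⟨e, he, hunit⟩ := hBu
  refine ⟨D, ⟨e, ?_, fun x hx => hunit x (MBundle.sections_mono hDB hx)⟩, hDc, hDB, hres, ?_⟩
  -- The unit of `B` is a central selection, and these all survive in `D`.
  · exact ((mem_centerIn _ _).1 (hcen ((mem_centerIn _ _).2
      ⟨he, fun x hx => (hunit x hx).2.trans (hunit x hx).1.symm⟩))).1
  ext x
  rw [(hDc.restrict X).mem_centerIn_sections]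
  constructor
  · intro hx t
    obtain ⟨z, hz, hzt⟩ := MBundle.mem_center.1 (hx t)
    rw [← hzt]
    exact hDc.mem_centerIn_sections.1 hz t
  · intro hx t
    refine hval x ?_ t
    rw [← hres]
    exact (hDc.restrict X).mem_centerIn_sections.2 hx
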